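/- Let $n\ge 2$ and let $D\subset\mathbb R^n$ be a bounded domain (a bounded, nonempty, connected open set; it is not assumed that $0\in D$). Let $V:D\to\mathbb R$ be measurable and suppose that at least one of the following holds: (i) $|V(x)|\le\left(\frac{n-2}{2}\right)^2|x|^{-2}$ for almost every $x\in D$; or (ii) $D$ is convex (no regularity of $\partial D$ is required; in particular $\partial D$ may be piecewise smooth) and $|V(x)|\le\frac14\,\mathrm{dist}(x,\partial D)^{-2}$ for almost every $x\in D$, where $\mathrm{dist}(x,\partial D)=\inf\{|x-y|:y\in\partial D\}$. Let $W^{1,2}_0(D)$ be the space of complex-valued $u\in L^2(D)$ with weak gradient $\nabla u\in L^2(D)$ for which there are $\varphi_k\in C_0^\infty(D)$ with $\varphi_k\to u$ and $\nabla\varphi_k\to\nabla u$ in $L^2(D)$. If $u\in W^{1,2}_0(D)$ satisfies $-\Delta u=Vu$ in $D$ in the distribution sense, that is, $$\int_D\nabla u\cdot\nabla\psi\,dx=\int_D V\,u\,\psi\,dx\qquad\text{for every complex-valued }\psi\in C_0^\infty(D)$$ (with $\cdot$ the bilinear product), then $u=0$ almost everywhere on $D$. -/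

import Mathlib

open MeasureTheory Filter Topology
open scoped Distributions ENNReal

namespace HardySchrodinger

/-- The classical partial derivative `∂ᵢ f (x)` of a function `f : ℝⁿ → ℂ`. -/
noncomputable def partialDeriv {n : ℕ} (i : Fin n) (f : EuclideanSpace ℝ (Fin n) → ℂ)
    (x : EuclideanSpace ℝ (Fin n)) : ℂ :=
  fderiv ℝ f x (EuclideanSpace.single i 1)

/-- `G = (G₁, …, Gₙ)` is the weak (distributional) gradient of `u` on the open set `D`:
both are locally integrable on `D`, and `∫_D u ∂ᵢψ = - ∫_D Gᵢ ψ` for every complex-valued test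
function `ψ ∈ C₀^∞(D)` and every `i`. -/
structure IsWeakGradient {n : ℕ} (D : TopologicalSpace.Opens (EuclideanSpace ℝ (Fin n)))
    (u : EuclideanSpace ℝ (Fin n) → ℂ) (G : Fin n → EuclideanSpace ℝ (Fin n) → ℂ) : Prop where
  locallyIntegrableOn : LocallyIntegrableOn u (D : Set (EuclideanSpace ℝ (Fin n)))
  locallyIntegrableOn_grad :
    ∀ i, LocallyIntegrableOn (G i) (D : Set (EuclideanSpace ℝ (Fin n)))
  integral_eq : ∀ (i : Fin n) (ψ : 𝓓(D, ℂ)),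
    ∫ x in (D : Set (EuclideanSpace ℝ (Fin n))), u x * partialDeriv i ψ x =
      - ∫ x in (D : Set (EuclideanSpace ℝ (Fin n))), G i x * ψ x

/-- The complex Sobolev space `W₀^{1,2}(D)`: the function `u` and its weak gradient `G` are in
`L²(D)`, and some sequence `φₖ` in `C₀^∞(D)` satisfies `φₖ → u` and `∇φₖ → G` in `L²(D)`. For
bounded `D`, Poincaré's inequality makes this the closure of `C₀^∞(D)` in the norm `‖∇u‖₂`. -/
def MemW012 {n : ℕ} (D : TopologicalSpace.Opens (EuclideanSpace ℝ (Fin n)))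
    (u : EuclideanSpace ℝ (Fin n) → ℂ) : Prop :=
  MemLp u 2 (volume.restrict (D : Set (EuclideanSpace ℝ (Fin n)))) ∧
  ∃ G : Fin n → EuclideanSpace ℝ (Fin n) → ℂ,
    IsWeakGradient D u G ∧
    (∀ i, MemLp (G i) 2 (volume.restrict (D : Set (EuclideanSpace ℝ (Fin n))))) ∧
    ∃ φ : ℕ → 𝓓(D, ℂ),
      Tendsto (fun k => eLpNorm (fun x => φ k x - u x) 2
        (volume.restrict (D : Set (EuclideanSpace ℝ (Fin n))))) atTop (𝓝 0) ∧
      ∀ i, Tendsto (fun k => eLpNorm (fun x => partialDeriv i (φ k) x - G i x) 2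
        (volume.restrict (D : Set (EuclideanSpace ℝ (Fin n))))) atTop (𝓝 0)

/-- `u` solves `-Δu = V u` on `D` in the distribution sense:
`∫_D ∇u · ∇ψ = ∫_D V u ψ` for every `ψ ∈ C₀^∞(D)`, where `∇u` is the weak gradient of `u` (it is
unique up to null sets) and `·` is the bilinear product. -/
def IsDistribSolution {n : ℕ} (D : TopologicalSpace.Opens (EuclideanSpace ℝ (Fin n)))
    (V : EuclideanSpace ℝ (Fin n) → ℝ) (u : EuclideanSpace ℝ (Fin n) → ℂ) : Prop :=
  ∃ G : Fin n → EuclideanSpace ℝ (Fin n) → ℂ,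
    IsWeakGradient D u G ∧
    ∀ ψ : 𝓓(D, ℂ),
      ∫ x in (D : Set (EuclideanSpace ℝ (Fin n))), ∑ i, G i x * partialDeriv i ψ x =
        ∫ x in (D : Set (EuclideanSpace ℝ (Fin n))), (V x : ℂ) * u x * ψ x

/-- The distance `dist(x, ∂D) = inf {|x - y| : y ∈ ∂D}` from `x` to the boundary of `D`. -/
noncomputable def distBoundary {n : ℕ}
    (D : TopologicalSpace.Opens (EuclideanSpace ℝ (Fin n)))
    (x : EuclideanSpace ℝ (Fin n)) : ℝ :=
  Metric.infDist x (frontier (D : Set (EuclideanSpace ℝ (Fin n))))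

end HardySchrodinger

/-! Both cases rest on a Hardy inequality with an `L²` remainder: `∫ (W + β)|φ|² ≤ ∫ |∇φ|²` for test
functions, with `β > 0` and `W` the given bound on `|V|`. Sharp constants leave no room in `W`
itself; boundedness of `D` supplies `β`.

Uniqueness (`ae_eq_zero_of_hardy`): Hardy passes to `u` by Fatou. Let `φₖ → u` in `W₀^{1,2}`.
Expanding `‖∇φₖ - ∇u‖²`, the cross term is `2 Re ∫ V u φ̄ₖ` by the equation, hence at most `∫ W|u|²
+ ∫ W|φₖ|²`. Hardy for `u` and for `φₖ` then leaves `β‖u‖² ≤ ‖∇φₖ - ∇u‖² → 0`.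

Hardy (`lintegral_mul_le_of_vectorField`): integrating `|∇φ + φF|² ≥ 0` by parts gives the weight
`div F - |F|²`. For the inverse square, `F` is a regularisation of `a x/|x|²`, `a = (n-2)/2`, plus
`βx`. For a convex `D`, each supporting half-space `{ℓⱼ > 0}` has the one-dimensional field
`f(ℓⱼ)νⱼ` with `f(t) = βt - 1/(2t)`. These are averaged with weights proportional to `e(ℓⱼ)^p`,
where `e' = 2fe`; the derivatives of the weights are exactly what Jensen's inequality needs. As `p →
∞` the average concentrates on the nearest hyperplane. -/

namespace HardySchrodinger

/-! ### Hardy inequalities from vector fields -/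

section VectorField

/-- The product of a function continuous on `D` and a continuous function compactly supported
in `D` is integrable. -/
lemma integrable_mul_of_tsupport_subset {E : Type*} [NormedAddCommGroup E] [MeasurableSpace E]
    [OpensMeasurableSpace E] {μ : Measure E} [IsFiniteMeasureOnCompacts μ] {D : Set E} {k ρ : E → ℝ}
    (hk : ContinuousOn k D)
    (hρ : Continuous ρ) (hc : HasCompactSupport ρ) (hs : tsupport ρ ⊆ D) :
    Integrable (fun x => k x * ρ x) μ := by
  rw [← integrableOn_iff_integrable_of_support_subset (s := tsupport ρ)]
  · exact ((hk.mono hs).mul hρ.continuousOn).integrableOn_compact hc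
  · intro x hx
    apply subset_tsupport
    intro h
    simp [h] at hx

variable {E : Type*} [NormedAddCommGroup E] [NormedSpace ℝ E] [FiniteDimensional ℝ E]
  [MeasurableSpace E] [BorelSpace E] {μ : Measure E} [μ.IsAddHaarMeasure]

/-- Integration by parts against a function compactly supported in the open set `D`. -/
lemma integral_mul_fderiv_of_tsupport_subset {D : Set E} (hD : IsOpen D) {h ρ : E → ℝ}
    (hh : ContDiffOn ℝ 1 h D) (hρ : ContDiff ℝ 1 ρ) (hc : HasCompactSupport ρ)
    (hs : tsupport ρ ⊆ D) (v : E) :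
    Integrable (fun x => fderiv ℝ h x v * ρ x) μ ∧ Integrable (fun x => h x * fderiv ℝ ρ x v) μ ∧
      ∫ x, h x * fderiv ℝ ρ x v ∂μ = - ∫ x, fderiv ℝ h x v * ρ x ∂μ := by
  have h1 : Integrable (fun x => fderiv ℝ h x v * ρ x) μ := by
    refine integrable_mul_of_tsupport_subset ?_ hρ.continuous hc hs
    exact (hh.continuousOn_fderiv_of_isOpen hD le_rfl).clm_apply continuousOn_const
  have h2 : Integrable (fun x => h x * fderiv ℝ ρ x v) μ := by
    refine integrable_mul_of_tsupport_subset hh.continuousOn ?_ ?_ ?_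
    · exact (hρ.continuous_fderiv one_ne_zero).clm_apply continuous_const
    · exact hc.fderiv_apply (𝕜 := ℝ) v
    · exact (tsupport_fderiv_apply_subset ℝ v).trans hs
  refine ⟨h1, h2, ?_⟩
  -- Differentiability of `h` is only needed on `tsupport ρ ⊆ D`, so its values outside `D` play no
  -- role.
  refine integral_bilinear_hasFDerivAt_right_eq_neg_left_of_integrable
    (B := ContinuousLinearMap.mul ℝ ℝ) (f := h) (f' := fderiv ℝ h) (g := ρ) (g' := fderiv ℝ ρ)
    h1 h2 (integrable_mul_of_tsupport_subset hh.continuousOn hρ.continuous hc hs) ?_ ?_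
  · intro x hx
    exact ((hh.contDiffAt (hD.mem_nhds (hs hx))).differentiableAt one_ne_zero).hasFDerivAt
  · intro x _
    exact (hρ.differentiable one_ne_zero x).hasFDerivAt

end VectorField

variable {n : ℕ}

lemma continuous_partialDeriv {D : TopologicalSpace.Opens (EuclideanSpace ℝ (Fin n))}
    (φ : 𝓓(D, ℂ)) (i : Fin n) : Continuous (partialDeriv i φ) := by
  have h : ContDiff ℝ 1 φ := φ.contDiff.of_le (by simp)
  exact (h.continuous_fderiv one_ne_zero).clm_apply continuous_const

lemma hasCompactSupport_partialDeriv {D : TopologicalSpace.Opens (EuclideanSpace ℝ (Fin n))}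
    (φ : 𝓓(D, ℂ)) (i : Fin n) : HasCompactSupport (partialDeriv i φ) :=
  φ.hasCompactSupport.fderiv_apply (𝕜 := ℝ) _

lemma fderiv_eq_sum_partialDeriv (f : EuclideanSpace ℝ (Fin n) → ℂ)
    (x v : EuclideanSpace ℝ (Fin n)) :
    fderiv ℝ f x v = ∑ i, v i • partialDeriv i f x := by
  conv_lhs => rw [← (EuclideanSpace.basisFun (Fin n) ℝ).sum_repr v]
  simp [partialDeriv, map_sum]

/-- Expanding `0 ≤ |∇φ + φ F|²`. -/
lemma neg_two_mul_inner_fderiv_sub_le (f : EuclideanSpace ℝ (Fin n) → ℂ)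
    (x F : EuclideanSpace ℝ (Fin n)) :
    -(2 * inner ℝ (f x) (fderiv ℝ f x F)) - ‖F‖ ^ 2 * ‖f x‖ ^ 2 ≤
      ∑ i, ‖partialDeriv i f x‖ ^ 2 := by
  have h : ∑ i, ‖F i • f x + partialDeriv i f x‖ ^ 2 =
      ‖F‖ ^ 2 * ‖f x‖ ^ 2 + 2 * inner ℝ (f x) (fderiv ℝ f x F) +
        ∑ i, ‖partialDeriv i f x‖ ^ 2 := by
    rw [EuclideanSpace.norm_sq_eq, Finset.sum_mul, fderiv_eq_sum_partialDeriv, inner_sum,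
      Finset.mul_sum, ← Finset.sum_add_distrib, ← Finset.sum_add_distrib]
    refine Finset.sum_congr rfl fun i _ => ?_
    rw [norm_add_sq_real, norm_smul, inner_smul_left, inner_smul_right, mul_pow]
    simp
  have h0 : 0 ≤ ∑ i, ‖F i • f x + partialDeriv i f x‖ ^ 2 := by positivity
  linarith

/-- **Hardy's inequality from a vector field**: a `C¹` field `F = ∑ⱼ hⱼ νⱼ` on `D` with
`0 ≤ q ≤ div F - |F|²` yields `∫ q |φ|² ≤ ∫ |∇φ|²`. -/
theorem lintegral_mul_le_of_vectorField
    {D : TopologicalSpace.Opens (EuclideanSpace ℝ (Fin n))} {ι : Type*} (s : Finset ι)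
    {h : ι → EuclideanSpace ℝ (Fin n) → ℝ} (ν : ι → EuclideanSpace ℝ (Fin n))
    (hh : ∀ j ∈ s, ContDiffOn ℝ 1 (h j) (D : Set (EuclideanSpace ℝ (Fin n))))
    {q : EuclideanSpace ℝ (Fin n) → ℝ}
    (hq0 : ∀ x ∈ D, 0 ≤ q x)
    (hq : ∀ x ∈ D, q x ≤ ∑ j ∈ s, fderiv ℝ (h j) x (ν j) - ‖∑ j ∈ s, h j x • ν j‖ ^ 2)
    (φ : 𝓓(D, ℂ)) :
    ∫⁻ x in (D : Set (EuclideanSpace ℝ (Fin n))), ENNReal.ofReal (q x) * ‖φ x‖ₑ ^ 2 ≤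
      ∫⁻ x in (D : Set (EuclideanSpace ℝ (Fin n))), ∑ i, ‖partialDeriv i φ x‖ₑ ^ 2 := by
  have hD := D.isOpen
  set ρ : EuclideanSpace ℝ (Fin n) → ℝ := fun x => ‖φ x‖ ^ 2 with hρdef
  have hφ : ContDiff ℝ 1 φ := φ.contDiff.of_le (by simp)
  have hρ : ContDiff ℝ 1 ρ := hφ.norm_sq ℝ
  have hcρ : HasCompactSupport ρ :=
    φ.hasCompactSupport.comp_left (g := fun z : ℂ => ‖z‖ ^ 2) (by simp)
  have hsρ : tsupport ρ ⊆ D :=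
    (closure_mono (Function.support_subset_iff'.2 fun x hx => by
      simp [hρdef, Function.notMem_support.1 hx])).trans φ.tsupport_subset
  have hdρ : ∀ x v, fderiv ℝ ρ x v = 2 * inner ℝ (φ x) (fderiv ℝ φ x v) := by
    intro x v
    rw [((hφ.differentiable one_ne_zero x).hasFDerivAt.norm_sq).fderiv]
    simp [mul_add]
  have hibp := fun j (hj : j ∈ s) => integral_mul_fderiv_of_tsupport_subset (μ := volume) hD
    (hh j hj) hρ hcρ hsρ (ν j)
  set A : EuclideanSpace ℝ (Fin n) → ℝ := fun x => ∑ i, ‖partialDeriv i φ x‖ ^ 2 with hA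
  have hAint : Integrable A := by
    refine integrable_finsetSum _ fun i _ => ?_
    refine Continuous.integrable_of_hasCompactSupport ((continuous_partialDeriv φ i).norm.pow 2) ?_
    exact (hasCompactSupport_partialDeriv φ i).comp_left (g := fun z : ℂ => ‖z‖ ^ 2) (by simp)
  -- With `F = ∑ hⱼ νⱼ`, `P = F · ∇|φ|²` and `Q = (div F)|φ|²`.
  set P : EuclideanSpace ℝ (Fin n) → ℝ := fun x => ∑ j ∈ s, h j x * fderiv ℝ ρ x (ν j) with hP
  have hPint : Integrable P := integrable_finsetSum _ fun j hj => (hibp j hj).2.1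
  set Q : EuclideanSpace ℝ (Fin n) → ℝ := fun x => ∑ j ∈ s, fderiv ℝ (h j) x (ν j) * ρ x with hQ
  have hQint : Integrable Q := integrable_finsetSum _ fun j hj => (hibp j hj).1
  have hPQ : ∫ x, P x = - ∫ x, Q x := by
    rw [hP, hQ, integral_finsetSum _ fun j hj => (hibp j hj).2.1,
      integral_finsetSum _ fun j hj => (hibp j hj).1, ← Finset.sum_neg_distrib]
    exact Finset.sum_congr rfl fun j hj => (hibp j hj).2.2
  set F : EuclideanSpace ℝ (Fin n) → EuclideanSpace ℝ (Fin n) := fun x => ∑ j ∈ s, h j x • ν j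
  have hBint : Integrable (fun x => ‖F x‖ ^ 2 * ρ x) := by
    refine integrable_mul_of_tsupport_subset (D := D) ?_ hρ.continuous hcρ hsρ
    exact (continuousOn_finsetSum s fun j hj =>
      (hh j hj).continuousOn.smul continuousOn_const).norm.pow 2
  have hpt : ∀ x, - P x - ‖F x‖ ^ 2 * ρ x ≤ A x := by
    intro x
    have := neg_two_mul_inner_fderiv_sub_le φ x (F x)
    have hPx : P x = 2 * inner ℝ (φ x) (fderiv ℝ φ x (F x)) := by
      simp only [hP, F, hdρ, map_sum, map_smul, inner_sum, inner_smul_right, Finset.mul_sum]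
      exact Finset.sum_congr rfl fun j _ => by ring
    rw [hPx]
    exact this
  have hnonneg : 0 ≤ᵐ[volume] fun x => A x + P x + ‖F x‖ ^ 2 * ρ x :=
    ae_of_all _ fun x => by have := hpt x; simp only [Pi.zero_apply]; linarith
  have hout : ∀ x, x ∉ D → φ x = 0 := fun x hx =>
    image_eq_zero_of_notMem_tsupport fun h' => hx (φ.tsupport_subset h')
  set T : EuclideanSpace ℝ (Fin n) → ℝ := fun x => Q x - ‖F x‖ ^ 2 * ρ x with hT
  have hTint : Integrable T := hQint.sub hBint
  have hTle : ∫ x, T x ≤ ∫ x, A x := by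
    have h0 := integral_nonneg_of_ae hnonneg
    rw [integral_add (f := fun x => A x + P x) (hAint.add hPint) hBint, integral_add hAint hPint,
      hPQ] at h0
    rw [hT, integral_sub hQint hBint]
    linarith
  have hqT : ∀ x ∈ D, q x * ρ x ≤ T x := by
    intro x hx
    simp only [hT, hQ, ← Finset.sum_mul, ← sub_mul]
    exact mul_le_mul_of_nonneg_right (hq x hx) (by positivity)
  have hT0 : ∀ x ∈ D, 0 ≤ T x := fun x hx =>
    (mul_nonneg (hq0 x hx) (by positivity)).trans (hqT x hx)
  have hDm : MeasurableSet (D : Set (EuclideanSpace ℝ (Fin n))) := hD.measurableSet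
  -- No measurability of `q` is available, so it is replaced by the integrable `T = (div F -
  -- |F|²)|φ|²` before real integrals are used.
  calc ∫⁻ x in (D : Set (EuclideanSpace ℝ (Fin n))), ENNReal.ofReal (q x) * ‖φ x‖ₑ ^ 2
      ≤ ∫⁻ x in (D : Set (EuclideanSpace ℝ (Fin n))), ENNReal.ofReal (T x) := by
        refine setLIntegral_mono' hDm fun x hx => ?_
        rw [← ofReal_norm, ← ENNReal.ofReal_pow (norm_nonneg _),
          ← ENNReal.ofReal_mul (hq0 x hx)]
        exact ENNReal.ofReal_le_ofReal (hqT x hx)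
    _ = ENNReal.ofReal (∫ x in (D : Set (EuclideanSpace ℝ (Fin n))), T x) :=
        (ofReal_integral_eq_lintegral_ofReal hTint.integrableOn
          ((ae_restrict_iff' hDm).2 (ae_of_all _ hT0))).symm
    _ ≤ ENNReal.ofReal (∫ x in (D : Set (EuclideanSpace ℝ (Fin n))), A x) := by
        refine ENNReal.ofReal_le_ofReal ?_
        rw [setIntegral_eq_integral_of_forall_compl_eq_zero,
          setIntegral_eq_integral_of_forall_compl_eq_zero]
        · exact hTle
        · intro x hx
          have : fderiv ℝ φ x = 0 := image_eq_zero_of_notMem_tsupport fun h' =>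
            hx (φ.tsupport_subset (tsupport_fderiv_subset ℝ h'))
          simp [hA, partialDeriv, this]
        · intro x hx
          simp [hT, hQ, hρdef, hout x hx]
    _ = ∫⁻ x in (D : Set (EuclideanSpace ℝ (Fin n))), ENNReal.ofReal (A x) :=
        ofReal_integral_eq_lintegral_ofReal hAint.integrableOn
          (ae_of_all _ fun x => by simp only [hA, Pi.zero_apply]; positivity)
    _ = _ := by
        refine lintegral_congr fun x => ?_
        rw [hA, ENNReal.ofReal_sum_of_nonneg fun i _ => by positivity]
        exact Finset.sum_congr rfl fun i _ => by
          rw [← ofReal_norm, ← ENNReal.ofReal_pow (norm_nonneg _)]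

/-! ### Limits of weights and the inverse square potential -/

/-- A Fatou-type limit in weighted integrals. -/
lemma lintegral_mul_le_of_le_liminf {α : Type*} [MeasurableSpace α] {μ : Measure α}
    {w : ℕ → α → ℝ≥0∞} {W g : α → ℝ≥0∞} {c : ℕ → ℝ≥0∞} {C : ℝ≥0∞} (hw : ∀ p, AEMeasurable (w p) μ)
    (hg : AEMeasurable g μ) (h : ∀ p, ∫⁻ x, w p x * g x ∂μ ≤ c p)
    (hc : Tendsto c atTop (𝓝 C)) (hW : ∀ᵐ x ∂μ, W x ≤ liminf (fun p => w p x) atTop) :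
    ∫⁻ x, W x * g x ∂μ ≤ C := by
  calc ∫⁻ x, W x * g x ∂μ ≤ ∫⁻ x, liminf (fun p => w p x * g x) atTop ∂μ := by
        refine lintegral_mono_ae ?_
        filter_upwards [hW] with x hx
        refine (mul_le_mul_left hx _).trans ?_
        have := ENNReal.le_liminf_mul (f := atTop) (u := fun p => w p x) (v := fun _ => g x)
        rwa [liminf_const] at this
    _ ≤ liminf (fun p => ∫⁻ x, w p x * g x ∂μ) atTop :=
        lintegral_liminf_le' fun p => (hw p).mul hg
    _ ≤ liminf c atTop := liminf_le_liminf (Eventually.of_forall h)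
    _ = C := hc.liminf_eq

/-- Hardy's inequality with the regularised inverse square weight. -/
lemma lintegral_regularized_inverse_square_le
    {D : TopologicalSpace.Opens (EuclideanSpace ℝ (Fin n))} {a β ε : ℝ} (ha0 : 0 ≤ a)
    (ha : (n : ℝ) = 2 * a + 2) (hβ : 0 < β) (hε : 0 < ε) (hR : ∀ x ∈ D, β * ‖x‖ ^ 2 ≤ 1)
    (φ : 𝓓(D, ℂ)) :
    ∫⁻ x in (D : Set (EuclideanSpace ℝ (Fin n))),
        ENNReal.ofReal (a ^ 2 * (‖x‖ ^ 2 + ε)⁻¹ + β) * ‖φ x‖ₑ ^ 2 ≤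
      ∫⁻ x in (D : Set (EuclideanSpace ℝ (Fin n))), ∑ i, ‖partialDeriv i φ x‖ₑ ^ 2 := by
  have hpos : ∀ x : EuclideanSpace ℝ (Fin n), 0 < ‖x‖ ^ 2 + ε := fun x => by positivity
  -- The field is `-∇ψ/ψ` for `ψ = (|x|² + ε)^(-a/2) exp(-β|x|²/2)`: `ε` keeps it smooth at the
  -- origin and the Gaussian factor produces the remainder `β`.
  refine lintegral_mul_le_of_vectorField Finset.univ
    (h := fun (i : Fin n) (x : EuclideanSpace ℝ (Fin n)) => (a * (‖x‖ ^ 2 + ε)⁻¹ + β) * x i)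
    (fun i => EuclideanSpace.single i 1) ?_ ?_ ?_ φ
  · intro i _
    have h1 : ContDiff ℝ 1 (fun x : EuclideanSpace ℝ (Fin n) => (‖x‖ ^ 2 + ε)⁻¹) :=
      ((contDiff_norm_sq ℝ).add contDiff_const).inv fun x => (hpos x).ne'
    have h2 : ContDiff ℝ 1 (fun x : EuclideanSpace ℝ (Fin n) => x i) :=
      (EuclideanSpace.proj i : EuclideanSpace ℝ (Fin n) →L[ℝ] ℝ).contDiff
    exact (((contDiff_const.mul h1).add contDiff_const).mul h2).contDiffOn
  · intro x _
    have := hpos x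
    positivity
  · intro x hx
    have hdiv : ∀ i, fderiv ℝ
        (fun x : EuclideanSpace ℝ (Fin n) => (a * (‖x‖ ^ 2 + ε)⁻¹ + β) * x i) x
        (EuclideanSpace.single i 1) =
        (a * (‖x‖ ^ 2 + ε)⁻¹ + β) - 2 * a * ((‖x‖ ^ 2 + ε)⁻¹) ^ 2 * x i ^ 2 := by
      intro i
      have h1 := ((hasFDerivAt_id x).norm_sq.add_const ε)
      have h1' := (((hasDerivAt_inv (hpos x).ne').comp_hasFDerivAt x h1).const_mul a).add_const β
      have h2 : HasFDerivAt (fun x : EuclideanSpace ℝ (Fin n) => x i)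
        (EuclideanSpace.proj i : EuclideanSpace ℝ (Fin n) →L[ℝ] ℝ) x :=
        (EuclideanSpace.proj i : EuclideanSpace ℝ (Fin n) →L[ℝ] ℝ).hasFDerivAt
      have h3 : fderiv ℝ
          (fun x : EuclideanSpace ℝ (Fin n) => (a * (‖x‖ ^ 2 + ε)⁻¹ + β) * x i) x = _ :=
        (h1'.mul h2).fderiv
      rw [h3]
      simp [EuclideanSpace.inner_single_right]
      ring
    simp only [hdiv]
    have hF : ∑ i, ((a * (‖x‖ ^ 2 + ε)⁻¹ + β) * x i) • (EuclideanSpace.single i (1 : ℝ)) =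
        (a * (‖x‖ ^ 2 + ε)⁻¹ + β) • x := by
      ext j
      simp [Pi.single_apply]
    rw [hF, norm_smul, mul_pow, Finset.sum_sub_distrib, ← Finset.mul_sum,
      ← EuclideanSpace.real_norm_sq_eq]
    have hx' := hR x hx
    have hs : 0 ≤ ‖x‖ ^ 2 := by positivity
    generalize ‖x‖ ^ 2 = s at *
    have ht : 0 < (s + ε)⁻¹ := by positivity
    have hst : s * (s + ε)⁻¹ ≤ 1 := by
      rw [← div_eq_mul_inv, div_le_one (by positivity)]; linarith
    generalize (s + ε)⁻¹ = t at *
    simp only [Finset.sum_const, Finset.card_univ, Fintype.card_fin, nsmul_eq_mul, ha,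
      Real.norm_eq_abs, sq_abs]
    -- Here `s = |x|²` and `t = 1/(s + ε)`. The surplus of `div F - |F|²` over the wanted weight is
    -- a sum of terms that are nonnegative because `st ≤ 1` and `βs ≤ 1`.
    have e1 : (2 * a + 2) * (a * t + β) - 2 * a * t ^ 2 * s - (a * t + β) ^ 2 * s - (a ^ 2 * t + β)
      = (2 * a + a ^ 2) * t * (1 - s * t) + 2 * a * β * (1 - s * t) + β * (1 - β * s) := by ring
    have : 0 ≤ (2 * a + a ^ 2) * t * (1 - s * t) + 2 * a * β * (1 - s * t) + β * (1 - β * s) := by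
      have h1 : 0 ≤ 1 - s * t := by linarith
      have h2 : 0 ≤ 1 - β * s := by linarith
      positivity
    linarith

/-- Hardy's inequality with the inverse square weight and an `L²` remainder. -/
theorem lintegral_inverse_square_le
    {D : TopologicalSpace.Opens (EuclideanSpace ℝ (Fin n))} {a β : ℝ} (ha0 : 0 ≤ a)
    (ha : (n : ℝ) = 2 * a + 2) (hβ : 0 < β) (hR : ∀ x ∈ D, β * ‖x‖ ^ 2 ≤ 1) (φ : 𝓓(D, ℂ)) :
    ∫⁻ x in (D : Set (EuclideanSpace ℝ (Fin n))),
        (ENNReal.ofReal (a ^ 2 * (‖x‖ ^ 2)⁻¹) + ENNReal.ofReal β) * ‖φ x‖ₑ ^ 2 ≤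
      ∫⁻ x in (D : Set (EuclideanSpace ℝ (Fin n))), ∑ i, ‖partialDeriv i φ x‖ₑ ^ 2 := by
  refine lintegral_mul_le_of_le_liminf
    (w := fun k x => ENNReal.ofReal (a ^ 2 * (‖x‖ ^ 2 + 1 / ((k : ℝ) + 1))⁻¹ + β)) ?_ ?_
    (fun k => lintegral_regularized_inverse_square_le ha0 ha hβ (by positivity) hR φ)
    tendsto_const_nhds ?_
  · intro k; fun_prop
  · have := φ.continuous; fun_prop
  · refine ae_of_all _ fun x => ?_
    rw [← ENNReal.ofReal_add (by positivity) hβ.le]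
    -- At the origin the convention `0⁻¹ = 0` reduces the target weight to `β`, which every
    -- regularised weight dominates.
    rcases eq_or_ne x 0 with rfl | hx
    · refine le_liminf_of_le (by isBoundedDefault) (Eventually.of_forall fun k => ?_)
      refine ENNReal.ofReal_le_ofReal ?_
      simp only [norm_zero]
      have : (0 : ℝ) ≤ a ^ 2 * (0 ^ 2 + 1 / ((k : ℝ) + 1))⁻¹ := by positivity
      simp only [ne_eq, OfNat.ofNat_ne_zero, not_false_eq_true, zero_pow, inv_zero, mul_zero] at *
      linarith
    · have h1 : Tendsto (fun k : ℕ => ‖x‖ ^ 2 + 1 / ((k : ℝ) + 1)) atTop (𝓝 (‖x‖ ^ 2 + 0)) :=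
        tendsto_const_nhds.add tendsto_one_div_add_atTop_nhds_zero_nat
      rw [add_zero] at h1
      have h2 := ((h1.inv₀ (by simpa using hx)).const_mul (a ^ 2)).add_const β
      exact (ENNReal.tendsto_ofReal h2).liminf_eq.ge

/-! ### The boundary distance on convex domains -/

section SoftMin

variable {E : Type*} [NormedAddCommGroup E] [InnerProductSpace ℝ E] {ι : Type*}

/-- A convex combination of multiples of unit vectors satisfies Jensen's inequality. -/
lemma norm_sum_smul_sq_le {s : Finset ι} {w f : ι → ℝ} {ν : ι → E} (hw : ∀ j ∈ s, 0 ≤ w j)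
    (hs : ∑ j ∈ s, w j = 1) (hν : ∀ j, ‖ν j‖ = 1) :
    ‖∑ j ∈ s, (w j * f j) • ν j‖ ^ 2 ≤ ∑ j ∈ s, w j * f j ^ 2 := by
  have h1 : ‖∑ j ∈ s, (w j * f j) • ν j‖ ≤ ∑ j ∈ s, w j * |f j| := by
    refine (norm_sum_le _ _).trans (Finset.sum_le_sum fun j hj => ?_)
    rw [norm_smul, hν, mul_one, Real.norm_eq_abs, abs_mul, abs_of_nonneg (hw j hj)]
  have h2 := Real.pow_arith_mean_le_arith_mean_pow s w (fun j => |f j|) hw hs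
    (fun j _ => abs_nonneg _) 2
  simp only [sq_abs] at h2
  exact (pow_le_pow_left₀ (norm_nonneg _) h1 2).trans h2

/-- The derivative of a term of the weighted field `∑ⱼ g(ℓⱼ) f(ℓⱼ) νⱼ / ∑ₖ g(ℓₖ)`, where
`ℓⱼ = ⟨νⱼ, ·⟩ - cⱼ` and `g' = c f g`. -/
lemma fderiv_weighted_field {s : Finset ι} {f f' g : ℝ → ℝ} {c : ℝ} {ν : ι → E} {b : ι → ℝ}
    {x : E} (hν : ∀ j, ‖ν j‖ = 1)
    (hf : ∀ j ∈ s, HasDerivAt f (f' (inner ℝ (ν j) x - b j)) (inner ℝ (ν j) x - b j))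
    (hg : ∀ j ∈ s, HasDerivAt g (c * f (inner ℝ (ν j) x - b j) * g (inner ℝ (ν j) x - b j))
      (inner ℝ (ν j) x - b j))
    (hS : ∑ k ∈ s, g (inner ℝ (ν k) x - b k) ≠ 0) {j : ι} (hj : j ∈ s) :
    fderiv ℝ (fun y => g (inner ℝ (ν j) y - b j) * (∑ k ∈ s, g (inner ℝ (ν k) y - b k))⁻¹ *
        f (inner ℝ (ν j) y - b j)) x (ν j) =
      g (inner ℝ (ν j) x - b j) * (∑ k ∈ s, g (inner ℝ (ν k) x - b k))⁻¹ *
        (f' (inner ℝ (ν j) x - b j) + c * f (inner ℝ (ν j) x - b j) ^ 2) -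
      c * inner ℝ ((g (inner ℝ (ν j) x - b j) * (∑ k ∈ s, g (inner ℝ (ν k) x - b k))⁻¹ *
          f (inner ℝ (ν j) x - b j)) • ν j)
        (∑ k ∈ s, (g (inner ℝ (ν k) x - b k) * (∑ k ∈ s, g (inner ℝ (ν k) x - b k))⁻¹ *
          f (inner ℝ (ν k) x - b k)) • ν k) := by
  have hl : ∀ k, HasFDerivAt (fun y : E => inner ℝ (ν k) y - b k) (innerSL ℝ (ν k)) x := fun k =>
    (innerSL ℝ (ν k)).hasFDerivAt.sub_const (b k)
  have hgl := fun k (hk : k ∈ s) => (hg k hk).comp_hasFDerivAt x (hl k)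
  have hfl := (hf j hj).comp_hasFDerivAt x (hl j)
  have hsum := HasFDerivAt.fun_sum hgl
  have hinv := (hasDerivAt_inv hS).comp_hasFDerivAt x hsum
  -- Write `wⱼ = g(ℓⱼ)/∑ g(ℓₖ)` and `F = ∑ wₖ f(ℓₖ) νₖ`. Since `g' = c f g`, the logarithmic
  -- derivative of `wⱼ` along `νⱼ` is `c f(ℓⱼ) - c⟨νⱼ, F⟩`.
  have h : fderiv ℝ (fun y => g (inner ℝ (ν j) y - b j) *
      (∑ k ∈ s, g (inner ℝ (ν k) y - b k))⁻¹ * f (inner ℝ (ν j) y - b j)) x = _ :=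
    (((hgl j hj).mul hinv).mul hfl).fderiv
  rw [h]
  simp only [add_apply, smul_apply, smul_eq_mul,
    innerSL_apply_apply, sum_apply, inner_sum, real_inner_smul_left, real_inner_smul_right,
    Pi.mul_apply, real_inner_self_eq_norm_sq, hν, Function.comp_def]
  have e : ∑ k ∈ s, c * f (inner ℝ (ν k) x - b k) * g (inner ℝ (ν k) x - b k) * inner ℝ (ν k) (ν j)
      = c * ∑ k ∈ s, f (inner ℝ (ν k) x - b k) * g (inner ℝ (ν k) x - b k) *
        inner ℝ (ν j) (ν k) := by
    rw [Finset.mul_sum]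
    exact Finset.sum_congr rfl fun k _ => by rw [real_inner_comm (ν j) (ν k)]; ring
  rw [e]
  have e2 : ∀ T A : ℝ, ∑ k ∈ s, g (inner ℝ (ν k) x - b k) * T * f (inner ℝ (ν k) x - b k) *
      (A * inner ℝ (ν j) (ν k)) = T * A * ∑ k ∈ s, f (inner ℝ (ν k) x - b k) *
        g (inner ℝ (ν k) x - b k) * inner ℝ (ν j) (ν k) := by
    intro T A
    rw [Finset.mul_sum]
    exact Finset.sum_congr rfl fun k _ => by ring
  rw [e2]
  generalize ∑ k ∈ s, f (inner ℝ (ν k) x - b k) * g (inner ℝ (ν k) x - b k) *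
        inner ℝ (ν j) (ν k) = T at *
  rw [← inv_pow]
  ring

end SoftMin

/-- Hardy's inequality for a weighted mean, with weights `g(ℓⱼ)`, of one-dimensional Hardy weights
in the directions `νⱼ`. -/
lemma lintegral_weighted_mean_le {D : TopologicalSpace.Opens (EuclideanSpace ℝ (Fin n))}
    {ι : Type*} {s : Finset ι} {f f' g r : ℝ → ℝ} {c : ℝ} (hc : 0 ≤ c)
    {ν : ι → EuclideanSpace ℝ (Fin n)} {b : ι → ℝ} {I : Set ℝ} (hs : s.Nonempty)
    (hν : ∀ j, ‖ν j‖ = 1) (hI : ∀ j ∈ s, ∀ x ∈ D, inner ℝ (ν j) x - b j ∈ I)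
    (hfc : ContDiffOn ℝ 1 f I) (hgc : ContDiffOn ℝ 1 g I)
    (hf : ∀ t ∈ I, HasDerivAt f (f' t) t) (hg : ∀ t ∈ I, HasDerivAt g (c * f t * g t) t)
    (hg0 : ∀ t ∈ I, 0 < g t) (hr0 : ∀ t ∈ I, 0 ≤ r t) (hr : ∀ t ∈ I, r t ≤ f' t - f t ^ 2)
    (φ : 𝓓(D, ℂ)) :
    ∫⁻ x in (D : Set (EuclideanSpace ℝ (Fin n))),
        ENNReal.ofReal (∑ j ∈ s, g (inner ℝ (ν j) x - b j) *
          (∑ k ∈ s, g (inner ℝ (ν k) x - b k))⁻¹ * r (inner ℝ (ν j) x - b j)) * ‖φ x‖ₑ ^ 2 ≤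
      ∫⁻ x in (D : Set (EuclideanSpace ℝ (Fin n))), ∑ i, ‖partialDeriv i φ x‖ₑ ^ 2 := by
  have hSpos : ∀ x ∈ D, 0 < ∑ k ∈ s, g (inner ℝ (ν k) x - b k) := fun x hx =>
    Finset.sum_pos (fun k hk => hg0 _ (hI k hk x hx)) hs
  refine lintegral_mul_le_of_vectorField s
    (h := fun j y => g (inner ℝ (ν j) y - b j) * (∑ k ∈ s, g (inner ℝ (ν k) y - b k))⁻¹ *
        f (inner ℝ (ν j) y - b j)) ν ?_ ?_ ?_ φ
  · intro j hj
    have hl : ∀ k, ContDiffOn ℝ 1 (fun y : EuclideanSpace ℝ (Fin n) => inner ℝ (ν k) y - b k)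
        (D : Set (EuclideanSpace ℝ (Fin n))) := fun k =>
      ((innerSL ℝ (ν k)).contDiff.sub contDiff_const).contDiffOn
    have hgl := fun k (hk : k ∈ s) => hgc.comp (hl k) (hI k hk)
    exact ((hgl j hj).mul ((ContDiffOn.sum hgl).inv fun x hx => (hSpos x hx).ne')).mul
      (hfc.comp (hl j) (hI j hj))
  · intro x hx
    refine Finset.sum_nonneg fun j hj => mul_nonneg (mul_nonneg ?_ ?_) (hr0 _ (hI j hj x hx))
    · exact (hg0 _ (hI j hj x hx)).le
    · exact inv_nonneg.2 (hSpos x hx).le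
  · intro x hx
    have hS := hSpos x hx
    rw [Finset.sum_congr rfl fun j hj => fderiv_weighted_field hν
      (fun k hk => hf _ (hI k hk x hx)) (fun k hk => hg _ (hI k hk x hx)) hS.ne' hj]
    rw [Finset.sum_sub_distrib, ← Finset.mul_sum, ← sum_inner, real_inner_self_eq_norm_sq]
    have hw0 : ∀ j ∈ s, 0 ≤ g (inner ℝ (ν j) x - b j) *
        (∑ k ∈ s, g (inner ℝ (ν k) x - b k))⁻¹ := fun j hj =>
      mul_nonneg (hg0 _ (hI j hj x hx)).le (inv_nonneg.2 hS.le)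
    have hw1 : ∑ j ∈ s, g (inner ℝ (ν j) x - b j) *
        (∑ k ∈ s, g (inner ℝ (ν k) x - b k))⁻¹ = 1 := by
      rw [← Finset.sum_mul, mul_inv_cancel₀ hS.ne']
    have hJ := norm_sum_smul_sq_le (f := fun j => f (inner ℝ (ν j) x - b j)) hw0 hw1 hν
    -- The weights contribute `c ∑ wⱼ f² - c|F|²` to `div F`, so `|F|²` enters `div F - |F|²` with
    -- factor `-(c + 1)`. Jensen replaces it by `∑ wⱼ f²`, leaving `∑ wⱼ (f' - f²)` for every `c ≥
    -- 0`.
    have hJ' := mul_le_mul_of_nonneg_left hJ (add_nonneg hc zero_le_one)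
    have hrw : ∑ j ∈ s, g (inner ℝ (ν j) x - b j) *
          (∑ k ∈ s, g (inner ℝ (ν k) x - b k))⁻¹ * r (inner ℝ (ν j) x - b j) ≤
        ∑ j ∈ s, g (inner ℝ (ν j) x - b j) * (∑ k ∈ s, g (inner ℝ (ν k) x - b k))⁻¹ *
          (f' (inner ℝ (ν j) x - b j) + c * f (inner ℝ (ν j) x - b j) ^ 2) -
        (c + 1) * ∑ j ∈ s, g (inner ℝ (ν j) x - b j) *
          (∑ k ∈ s, g (inner ℝ (ν k) x - b k))⁻¹ * f (inner ℝ (ν j) x - b j) ^ 2 := by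
      rw [Finset.mul_sum, ← Finset.sum_sub_distrib]
      refine Finset.sum_le_sum fun j hj => ?_
      refine (mul_le_mul_of_nonneg_left (hr _ (hI j hj x hx)) (hw0 j hj)).trans_eq ?_
      ring
    linarith

/-- Powers of weights concentrate on the indices where the base is largest. -/
lemma ofReal_le_liminf_weighted_mean {ι : Type*} {s : Finset ι} {e r : ι → ℝ}
    (he : ∀ i ∈ s, 0 < e i) (hr : ∀ i ∈ s, 0 ≤ r i)
    (her : ∀ i ∈ s, ∀ j ∈ s, r i < r j → e i < e j) {j : ι} (hj : j ∈ s) :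
    ENNReal.ofReal (r j) ≤ liminf (fun p : ℕ =>
      ENNReal.ofReal (∑ i ∈ s, e i ^ p * (∑ k ∈ s, e k ^ p)⁻¹ * r i)) atTop := by
  classical
  -- Indices in `t` have weight at most `(eᵢ/eⱼ)^p → 0`; all others, ties included, have `rᵢ ≥ rⱼ`.
  set t := s.filter fun i => r i < r j with ht
  have hlim : Tendsto (fun p : ℕ => r j * (1 - ∑ i ∈ t, (e i / e j) ^ p)) atTop (𝓝 (r j)) := by
    have h0 : Tendsto (fun p : ℕ => ∑ i ∈ t, (e i / e j) ^ p) atTop (𝓝 (∑ i ∈ t, 0)) := by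
      refine tendsto_finsetSum _ fun i hi => ?_
      obtain ⟨his, hi⟩ := Finset.mem_filter.1 hi
      exact tendsto_pow_atTop_nhds_zero_of_lt_one (div_pos (he i his) (he j hj)).le
        ((div_lt_one (he j hj)).2 (her i his j hj hi))
    simpa using (h0.const_sub 1).const_mul (r j)
  rw [← (ENNReal.tendsto_ofReal hlim).liminf_eq]
  refine liminf_le_liminf (Eventually.of_forall fun p => ENNReal.ofReal_le_ofReal ?_)
  have hS : 0 < ∑ k ∈ s, e k ^ p := Finset.sum_pos (fun k hk => pow_pos (he k hk) p) ⟨j, hj⟩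
  have hw0 : ∀ i ∈ s, 0 ≤ e i ^ p * (∑ k ∈ s, e k ^ p)⁻¹ := fun i hi =>
    mul_nonneg (pow_pos (he i hi) p).le (inv_nonneg.2 hS.le)
  have hw1 : ∑ i ∈ s, e i ^ p * (∑ k ∈ s, e k ^ p)⁻¹ = 1 := by
    rw [← Finset.sum_mul, mul_inv_cancel₀ hS.ne']
  have hwt : ∑ i ∈ t, e i ^ p * (∑ k ∈ s, e k ^ p)⁻¹ ≤ ∑ i ∈ t, (e i / e j) ^ p := by
    refine Finset.sum_le_sum fun i hi => ?_
    rw [div_pow, div_eq_mul_inv]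
    refine mul_le_mul_of_nonneg_left ?_ (pow_pos (he i (Finset.mem_filter.1 hi).1) p).le
    exact inv_anti₀ (pow_pos (he j hj) p)
      (Finset.single_le_sum (f := fun k => e k ^ p) (fun k hk => (pow_pos (he k hk) p).le) hj)
  calc r j * (1 - ∑ i ∈ t, (e i / e j) ^ p)
      ≤ r j * (1 - ∑ i ∈ t, e i ^ p * (∑ k ∈ s, e k ^ p)⁻¹) :=
        mul_le_mul_of_nonneg_left (by linarith) (hr j hj)
    _ = ∑ i ∈ s.filter (fun i => ¬ r i < r j), e i ^ p * (∑ k ∈ s, e k ^ p)⁻¹ * r j := by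
        change r j * (1 - ∑ i ∈ s.filter (fun i => r i < r j), _) = _
        rw [← hw1, ← Finset.sum_filter_add_sum_filter_not s (fun i => r i < r j)
          (fun i => e i ^ p * (∑ k ∈ s, e k ^ p)⁻¹), add_sub_cancel_left, mul_comm,
          Finset.sum_mul]
    _ ≤ ∑ i ∈ s.filter (fun i => ¬ r i < r j), e i ^ p * (∑ k ∈ s, e k ^ p)⁻¹ * r i := by
        refine Finset.sum_le_sum fun i hi => ?_
        obtain ⟨his, hi⟩ := Finset.mem_filter.1 hi
        exact mul_le_mul_of_nonneg_left (not_lt.1 hi) (hw0 i his)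
    _ ≤ ∑ i ∈ s, e i ^ p * (∑ k ∈ s, e k ^ p)⁻¹ * r i :=
        Finset.sum_le_sum_of_subset_of_nonneg (Finset.filter_subset _ _) fun i hi _ =>
          mul_nonneg (hw0 i hi) (hr i hi)

/-- `t ↦ exp (β t²) / t` is decreasing where `2 β t² < 1`. -/
lemma exp_mul_sq_mul_inv_lt {β a b : ℝ} (hβ : 0 < β) (hb : 0 < b) (hba : b < a)
    (ha : 2 * β * a ^ 2 < 1) :
    Real.exp (β * a ^ 2) * a⁻¹ < Real.exp (β * b ^ 2) * b⁻¹ := by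
  have ha0 : 0 < a := hb.trans hba
  -- After cancelling `exp(βa²)` the claim is `b/a < exp(-β(a² - b²))`, which follows from `1 + y ≤
  -- exp y`.
  have h1 : β * b ^ 2 = β * a ^ 2 + -(β * (a ^ 2 - b ^ 2)) := by ring
  have h2 := Real.add_one_le_exp (-(β * (a ^ 2 - b ^ 2)))
  have h3 : b < a * (-(β * (a ^ 2 - b ^ 2)) + 1) := by
    have h4 : a * (-(β * (a ^ 2 - b ^ 2)) + 1) - b = (a - b) * (1 - β * (a * (a + b))) := by ring
    have h5 : a * (a + b) ≤ 2 * a ^ 2 := by nlinarith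
    have h6 : 0 < 1 - β * (a * (a + b)) := by nlinarith
    have := mul_pos (sub_pos.2 hba) h6
    linarith
  rw [h1, Real.exp_add, mul_assoc]
  refine mul_lt_mul_of_pos_left ?_ (Real.exp_pos _)
  rw [← div_eq_mul_inv, lt_div_iff₀ hb, ← div_eq_inv_mul, div_lt_iff₀ ha0]
  nlinarith

/-- Hardy's inequality for finitely many half-spaces containing `D`. -/
lemma lintegral_iSup_halfSpace_le {D : TopologicalSpace.Opens (EuclideanSpace ℝ (Fin n))}
    {ι : Type*} {s : Finset ι} {ν : ι → EuclideanSpace ℝ (Fin n)} {b : ι → ℝ}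
    {β : ℝ} (hβ : 0 < β) (hs : s.Nonempty) (hν : ∀ j, ‖ν j‖ = 1)
    (hpos : ∀ j, ∀ x ∈ D, 0 < inner ℝ (ν j) x - b j)
    (hle : ∀ j, ∀ x ∈ D, 4 * β * (inner ℝ (ν j) x - b j) ^ 2 ≤ 1) (φ : 𝓓(D, ℂ)) :
    ∫⁻ x in (D : Set (EuclideanSpace ℝ (Fin n))),
        (⨆ j ∈ s, ENNReal.ofReal (((inner ℝ (ν j) x - b j) ^ 2)⁻¹ / 4 + β)) * ‖φ x‖ₑ ^ 2 ≤
      ∫⁻ x in (D : Set (EuclideanSpace ℝ (Fin n))), ∑ i, ‖partialDeriv i φ x‖ₑ ^ 2 := by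
  set I : Set ℝ := {t | 0 < t ∧ 4 * β * t ^ 2 ≤ 1} with hI
  -- `e` solves `e' = 2fe` for `f(t) = βt - 1/(2t)`, so `g = e^p` satisfies `g' = c f g` with `c =
  -- 2p`.
  set e : ℝ → ℝ := fun t => Real.exp (β * t ^ 2) * t⁻¹ with he
  have he0 : ∀ t ∈ I, 0 < e t := fun t ht => mul_pos (Real.exp_pos _) (inv_pos.2 ht.1)
  have hne : ∀ t ∈ I, t ≠ 0 := fun t ht => ht.1.ne'
  have hexp : ContDiff ℝ 1 (fun t : ℝ => Real.exp (β * t ^ 2)) := by fun_prop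
  have hinv : ContDiffOn ℝ 1 (fun t : ℝ => t⁻¹) I := contDiffOn_id.inv hne
  have hde : ∀ t ∈ I, HasDerivAt e (2 * (β * t - t⁻¹ / 2) * e t) t := by
    intro t ht
    have h1 := (((hasDerivAt_pow 2 t).const_mul β).exp).mul (hasDerivAt_inv (hne t ht))
    refine h1.congr_deriv ?_
    have := hne t ht
    simp only [he]
    field_simp
    push_cast
    ring
  have hm : ∀ j, Measurable fun x : EuclideanSpace ℝ (Fin n) => inner ℝ (ν j) x - b j := fun j => by
    fun_prop
  refine lintegral_mul_le_of_le_liminf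
    (w := fun p x => ENNReal.ofReal (∑ j ∈ s, e (inner ℝ (ν j) x - b j) ^ p *
          (∑ k ∈ s, e (inner ℝ (ν k) x - b k) ^ p)⁻¹ *
            (((inner ℝ (ν j) x - b j) ^ 2)⁻¹ / 4 + β))) (fun p => ?_) ?_ (fun p =>
    lintegral_weighted_mean_le (c := 2 * p) (f := fun t => β * t - t⁻¹ / 2)
      (f' := fun t => β + (t ^ 2)⁻¹ / 2) (g := fun t => e t ^ p)
      (r := fun t => (t ^ 2)⁻¹ / 4 + β) (I := I) (by positivity) hs hν
      (fun j _ x hx => ⟨hpos j x hx, hle j x hx⟩) ?_ ?_ ?_ ?_ ?_ ?_ ?_ φ)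
    tendsto_const_nhds ?_
  · have he' : Measurable e := by fun_prop
    have : ∀ j, Measurable fun x : EuclideanSpace ℝ (Fin n) => e (inner ℝ (ν j) x - b j) :=
      fun j => he'.comp (hm j)
    fun_prop
  · have := φ.continuous
    fun_prop
  · exact (contDiffOn_const.mul contDiffOn_id).sub (hinv.div_const 2)
  · exact (hexp.contDiffOn.mul hinv).pow p
  · intro t ht
    refine (((hasDerivAt_id t).const_mul β).sub
      ((hasDerivAt_inv (hne t ht)).div_const 2)).congr_deriv ?_
    ring
  · intro t ht
    refine ((hde t ht).pow p).congr_deriv ?_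
    -- The exponent `p - 1` is truncated at `p = 0`, where both sides vanish.
    rcases p with _ | p
    · simp
    · simp only [Nat.add_sub_cancel]; ring
  · exact fun t ht => pow_pos (he0 t ht) p
  · intro t ht
    positivity
  · intro t ht
    have h1 : t * t⁻¹ = 1 := mul_inv_cancel₀ (hne t ht)
    -- `f' - f² = 1/(4t²) + 2β - β²t²`, which is at least `1/(4t²) + β` as `βt² ≤ 1`.
    have h2 : β + (t ^ 2)⁻¹ / 2 - (β * t - t⁻¹ / 2) ^ 2 =
        (t ^ 2)⁻¹ / 4 + β + β * (t * t⁻¹) - β * (β * t ^ 2) := by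
      rw [← inv_pow]; ring
    rw [h2, h1]
    have h3 : β * t ^ 2 ≤ 1 := by nlinarith [ht.2, sq_nonneg t]
    nlinarith
  · rw [ae_restrict_iff' D.isOpen.measurableSet]
    refine ae_of_all _ fun x hx => iSup₂_le fun j hj => ?_
    refine ofReal_le_liminf_weighted_mean (e := fun j => e (inner ℝ (ν j) x - b j))
      (r := fun j => ((inner ℝ (ν j) x - b j) ^ 2)⁻¹ / 4 + β) ?_ ?_ ?_ hj
    · exact fun i _ => he0 _ ⟨hpos i x hx, hle i x hx⟩
    · exact fun i _ => by positivity
    -- A larger weight means a nearer hyperplane, where `e` is larger; `4βt² ≤ 1` keeps `t` in the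
    -- range where `e` decreases.
    · intro i _ j _ hij
      have hi := hpos i x hx
      have hj := hpos j x hx
      have h1 : ((inner ℝ (ν i) x - b i) ^ 2)⁻¹ < ((inner ℝ (ν j) x - b j) ^ 2)⁻¹ := by linarith
      rw [inv_lt_inv₀ (by positivity) (by positivity)] at h1
      refine exp_mul_sq_mul_inv_lt hβ hj (lt_of_pow_lt_pow_left₀ 2 hi.le h1) ?_
      have := hle i x hx
      linarith

/-- A supporting half-space of an open convex set at a boundary point. -/
lemma exists_unit_inner_lt {E : Type*} [NormedAddCommGroup E] [InnerProductSpace ℝ E]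
    [CompleteSpace E] {D : Set E} (hD : IsOpen D) (hc : Convex ℝ D) (hne : D.Nonempty) {y : E}
    (hy : y ∉ D) : ∃ ν : E, ‖ν‖ = 1 ∧ ∀ x ∈ D, inner ℝ ν y < inner ℝ ν x := by
  obtain ⟨f, hf⟩ := geometric_hahn_banach_point_open hc hD hy
  set v := (InnerProductSpace.toDual ℝ E).symm f with hv
  have hfv : ∀ x, f x = inner ℝ v x := fun x => by simp [hv]
  obtain ⟨x₀, hx₀⟩ := hne
  have hv0 : v ≠ 0 := by
    intro h
    have := hf x₀ hx₀
    simp [hfv, h] at this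
  refine ⟨‖v‖⁻¹ • v, norm_smul_inv_norm hv0, fun x hx => ?_⟩
  have := hf x hx
  rw [hfv, hfv] at this
  simp only [inner_smul_left]
  exact mul_lt_mul_of_pos_left this (by simpa using hv0)

/-- Hardy's inequality on a bounded convex domain, with the optimal constant and an `L²`
remainder. -/
theorem lintegral_inverse_square_distBoundary_le
    {D : TopologicalSpace.Opens (EuclideanSpace ℝ (Fin n))}
    (hc : Convex ℝ (D : Set (EuclideanSpace ℝ (Fin n))))
    (hne : (D : Set (EuclideanSpace ℝ (Fin n))).Nonempty)
    (hfr : (frontier (D : Set (EuclideanSpace ℝ (Fin n)))).Nonempty)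
    {β R : ℝ} (hβ : 0 < β) (hR : ∀ x ∈ D, ‖x‖ ≤ R) (hβR : 16 * β * R ^ 2 ≤ 1) (φ : 𝓓(D, ℂ)) :
    ∫⁻ x in (D : Set (EuclideanSpace ℝ (Fin n))),
        (ENNReal.ofReal (1 / 4 * (distBoundary D x ^ 2)⁻¹) + ENNReal.ofReal β) * ‖φ x‖ₑ ^ 2 ≤
      ∫⁻ x in (D : Set (EuclideanSpace ℝ (Fin n))), ∑ i, ‖partialDeriv i φ x‖ₑ ^ 2 := by
  have : Nonempty (frontier (D : Set (EuclideanSpace ℝ (Fin n)))) := hfr.to_subtype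
  have hyD : ∀ y ∈ frontier (D : Set (EuclideanSpace ℝ (Fin n))), y ∉ (D : Set _) := fun y hy => by
    rw [D.isOpen.frontier_eq] at hy
    exact hy.2
  -- Countably many supporting half-spaces suffice: `ℓⱼ(x) ≤ |x - yⱼ|`, and by density `inf |x -
  -- yⱼ|` is the distance to the boundary. No smoothness of the boundary is needed.
  set y := TopologicalSpace.denseSeq (frontier (D : Set (EuclideanSpace ℝ (Fin n)))) with hy
  choose ν hν hlt using fun j => exists_unit_inner_lt D.isOpen hc hne (hyD _ (y j).2)
  have hpos : ∀ j, ∀ x ∈ D, 0 < inner ℝ (ν j) x - inner ℝ (ν j) (y j : EuclideanSpace ℝ (Fin n)) :=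
    fun j x hx => sub_pos.2 (hlt j x hx)
  have hdist : ∀ j x, inner ℝ (ν j) x - inner ℝ (ν j) (y j : EuclideanSpace ℝ (Fin n)) ≤
      dist x (y j) := by
    intro j x
    rw [← inner_sub_right, dist_eq_norm]
    simpa [hν] using real_inner_le_norm (ν j) (x - y j)
  have hyR : ∀ j, ‖(y j : EuclideanSpace ℝ (Fin n))‖ ≤ R := by
    intro j
    have h1 : (D : Set (EuclideanSpace ℝ (Fin n))) ⊆ Metric.closedBall 0 R := fun x hx => by
      simpa using hR x hx
    simpa using closure_minimal h1 Metric.isClosed_closedBall (frontier_subset_closure (y j).2)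
  have hle : ∀ j, ∀ x ∈ D,
      4 * β * (inner ℝ (ν j) x - inner ℝ (ν j) (y j : EuclideanSpace ℝ (Fin n))) ^ 2 ≤ 1 := by
    intro j x hx
    -- The width `2R` turns `4βℓ² ≤ 1` into the hypothesis `16βR² ≤ 1`.
    have h1 : inner ℝ (ν j) x - inner ℝ (ν j) (y j : EuclideanSpace ℝ (Fin n)) ≤ 2 * R := by
      refine (hdist j x).trans ?_
      rw [dist_eq_norm]
      have := norm_sub_le x (y j : EuclideanSpace ℝ (Fin n))
      linarith [hR x hx, hyR j]
    have h2 := pow_le_pow_left₀ (hpos j x hx).le h1 2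
    nlinarith
  refine lintegral_mul_le_of_le_liminf (fun N => ?_) ?_ (fun N => lintegral_iSup_halfSpace_le hβ
    (s := Finset.range (N + 1)) ⟨0, by simp⟩ hν hpos hle φ) tendsto_const_nhds ?_
  · refine (Measurable.iSup fun j => Measurable.iSup fun _ => ?_).aemeasurable
    fun_prop
  · have := φ.continuous
    fun_prop
  rw [ae_restrict_iff' D.isOpen.measurableSet]
  refine ae_of_all _ fun x hx => ?_
  have hδ : 0 < distBoundary D x :=
    (isClosed_frontier.notMem_iff_infDist_pos hfr).1
      fun h => hyD x h hx
  have hj : ∀ j, ENNReal.ofReal (((inner ℝ (ν j) x -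
      inner ℝ (ν j) (y j : EuclideanSpace ℝ (Fin n))) ^ 2)⁻¹ / 4 + β) ≤
      liminf (fun N => ⨆ j ∈ Finset.range (N + 1), ENNReal.ofReal (((inner ℝ (ν j) x -
      inner ℝ (ν j) (y j : EuclideanSpace ℝ (Fin n))) ^ 2)⁻¹ / 4 + β)) atTop := by
    intro j
    refine le_liminf_of_le (by isBoundedDefault) ?_
    filter_upwards [eventually_ge_atTop j] with N hN
    exact le_iSup₂ (f := fun j (_ : j ∈ Finset.range (N + 1)) => ENNReal.ofReal (((inner ℝ (ν j) x -
      inner ℝ (ν j) (y j : EuclideanSpace ℝ (Fin n))) ^ 2)⁻¹ / 4 + β)) j (by simp; omega)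
  rw [← ENNReal.ofReal_add (by positivity) hβ.le]
  -- The distance need not be attained along the dense sequence, so it is approached with slack
  -- `1/(k + 1)`.
  have hlim : Tendsto (fun k : ℕ => ENNReal.ofReal
      (1 / 4 * ((distBoundary D x + 1 / ((k : ℝ) + 1)) ^ 2)⁻¹ + β)) atTop
      (𝓝 (ENNReal.ofReal (1 / 4 * (distBoundary D x ^ 2)⁻¹ + β))) := by
    refine ENNReal.tendsto_ofReal ?_
    have h1 : Tendsto (fun k : ℕ => distBoundary D x + 1 / ((k : ℝ) + 1)) atTop
        (𝓝 (distBoundary D x + 0)) :=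
      tendsto_const_nhds.add tendsto_one_div_add_atTop_nhds_zero_nat
    rw [add_zero] at h1
    exact (((h1.pow 2).inv₀ (by positivity)).const_mul _).add_const β
  refine le_of_tendsto' hlim fun k => ?_
  obtain ⟨z, hz, hxz⟩ := (Metric.infDist_lt_iff hfr).1
    (lt_add_of_pos_right (distBoundary D x) (by positivity : (0 : ℝ) < 1 / ((k : ℝ) + 1)))
  obtain ⟨j, hjz⟩ : ∃ j, dist x (y j) < distBoundary D x + 1 / ((k : ℝ) + 1) := by
    have ho : IsOpen {z : frontier (D : Set (EuclideanSpace ℝ (Fin n))) |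
        dist x z < distBoundary D x + 1 / ((k : ℝ) + 1)} :=
      isOpen_lt (by fun_prop) continuous_const
    exact (TopologicalSpace.denseRange_denseSeq _).exists_mem_open ho ⟨⟨z, hz⟩, hxz⟩
  refine le_trans (ENNReal.ofReal_le_ofReal ?_) (hj j)
  have h1 := (hdist j x).trans hjz.le
  have h2 := inv_anti₀ (pow_pos (hpos j x hx) 2) (pow_le_pow_left₀ (hpos j x hx).le h1 2)
  linarith

/-! ### From Hardy's inequality to uniqueness -/

lemma lintegral_enorm_sq_eq_eLpNorm {α F : Type*} [MeasurableSpace α] [NormedAddCommGroup F]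
    (μ : Measure α) (f : α → F) : ∫⁻ x, ‖f x‖ₑ ^ 2 ∂μ = eLpNorm f 2 μ ^ 2 := by
  have := eLpNorm_nnreal_pow_eq_lintegral (f := f) (μ := μ) (p := 2) (by norm_num)
  simpa using this.symm

/-- Weak gradients are unique up to null sets. -/
lemma IsWeakGradient.ae_eq {D : TopologicalSpace.Opens (EuclideanSpace ℝ (Fin n))}
    {u : EuclideanSpace ℝ (Fin n) → ℂ} {G G' : Fin n → EuclideanSpace ℝ (Fin n) → ℂ}
    (h : IsWeakGradient D u G) (h' : IsWeakGradient D u G') (i : Fin n) :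
    G i =ᵐ[volume.restrict (D : Set (EuclideanSpace ℝ (Fin n)))] G' i := by
  have key := D.isOpen.ae_eq_zero_of_integral_contDiff_smul_eq_zero (μ := volume)
    ((h.locallyIntegrableOn_grad i).sub (h'.locallyIntegrableOn_grad i)) ?_
  · rw [Filter.EventuallyEq, ae_restrict_iff' D.isOpen.measurableSet]
    filter_upwards [key] with x hx hxD
    exact sub_eq_zero.1 (hx hxD)
  · intro g hg hgc hgs
    -- The fundamental lemma tests against real functions only; each is regarded as a complex test
    -- function.
    let ψ : 𝓓(D, ℂ) := ⟨fun x => (g x : ℂ), Complex.ofRealCLM.contDiff.comp hg,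
      hgc.comp_left (g := Complex.ofReal) (by simp),
      (closure_mono (Function.support_subset_iff'.2 fun x hx => by
        simp [Function.notMem_support.1 hx])).trans hgs⟩
    have e := (h.integral_eq i ψ).symm.trans (h'.integral_eq i ψ)
    rw [neg_inj] at e
    have hint : ∀ f : EuclideanSpace ℝ (Fin n) → ℂ,
        LocallyIntegrableOn f (D : Set (EuclideanSpace ℝ (Fin n))) →
        IntegrableOn (fun x => f x * ψ x) (D : Set (EuclideanSpace ℝ (Fin n))) := by
      intro f hf
      have h1 : IntegrableOn (fun x => f x * ψ x) (tsupport ψ) :=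
        (hf.integrableOn_compact_subset ψ.tsupport_subset ψ.hasCompactSupport).mul_continuousOn
          ψ.continuous.continuousOn ψ.hasCompactSupport
      refine (h1.of_forall_sdiff_eq_zero ?_ ?_)
      · exact D.isOpen.measurableSet
      · intro x hx
        simp [image_eq_zero_of_notMem_tsupport hx.2]
    rw [← setIntegral_eq_integral_of_forall_compl_eq_zero
      (s := (D : Set (EuclideanSpace ℝ (Fin n))))]
    · have := integral_sub (hint _ (h.locallyIntegrableOn_grad i))
        (hint _ (h'.locallyIntegrableOn_grad i))
      rw [e, sub_self] at this
      rw [← this]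
      refine integral_congr_ae (ae_of_all _ fun x => ?_)
      change (g x) • (G i x - G' i x) = G i x * (g x : ℂ) - G' i x * (g x : ℂ)
      rw [Complex.real_smul]; ring
    · intro x hx
      rw [image_eq_zero_of_notMem_tsupport fun h => hx (hgs h), zero_smul]

/-- The complex conjugate of a test function. -/
noncomputable def conjTestFunction {D : TopologicalSpace.Opens (EuclideanSpace ℝ (Fin n))}
    (φ : 𝓓(D, ℂ)) : 𝓓(D, ℂ) :=
  ⟨fun x => starRingEnd ℂ (φ x), Complex.conjCLE.contDiff.comp φ.contDiff,
    φ.hasCompactSupport.comp_left (g := starRingEnd ℂ) (by simp),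
    (closure_mono (Function.support_subset_iff'.2 fun x hx => by
        simp [Function.notMem_support.1 hx])).trans φ.tsupport_subset⟩

lemma conjTestFunction_apply {D : TopologicalSpace.Opens (EuclideanSpace ℝ (Fin n))}
    (φ : 𝓓(D, ℂ)) (x : EuclideanSpace ℝ (Fin n)) :
    conjTestFunction φ x = starRingEnd ℂ (φ x) := rfl

lemma partialDeriv_conjTestFunction {D : TopologicalSpace.Opens (EuclideanSpace ℝ (Fin n))}
    (φ : 𝓓(D, ℂ)) (i : Fin n) (x : EuclideanSpace ℝ (Fin n)) :
    partialDeriv i (conjTestFunction φ) x = starRingEnd ℂ (partialDeriv i φ x) := by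
  have h : ContDiff ℝ 1 φ := φ.contDiff.of_le (by simp)
  have := (Complex.conjCLE.toContinuousLinearMap.hasFDerivAt.comp x
    (h.differentiable one_ne_zero x).hasFDerivAt).fderiv
  unfold partialDeriv
  change fderiv ℝ (Complex.conjCLE.toContinuousLinearMap ∘ φ) x _ = _
  rw [this]; rfl

/-- The weak limit argument: if the quadratic form of `-Δ - W` controls `β ‖·‖²` on test functions
and `|V| ≤ W`, then `-Δu = Vu` has no nontrivial solution in `W₀^{1,2}`. -/
theorem ae_eq_zero_of_hardy {D : TopologicalSpace.Opens (EuclideanSpace ℝ (Fin n))}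
    {W : EuclideanSpace ℝ (Fin n) → ℝ≥0∞}
    (hW : AEMeasurable W (volume.restrict (D : Set (EuclideanSpace ℝ (Fin n)))))
    {β : ℝ} (hβ : 0 < β)
    (hardy : ∀ φ : 𝓓(D, ℂ),
      ∫⁻ x in (D : Set (EuclideanSpace ℝ (Fin n))), (W x + ENNReal.ofReal β) * ‖φ x‖ₑ ^ 2 ≤
        ∫⁻ x in (D : Set (EuclideanSpace ℝ (Fin n))), ∑ i, ‖partialDeriv i φ x‖ₑ ^ 2)
    {V : EuclideanSpace ℝ (Fin n) → ℝ}
    (hV : ∀ᵐ x ∂(volume.restrict (D : Set (EuclideanSpace ℝ (Fin n)))),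
      ENNReal.ofReal |V x| ≤ W x)
    {u : EuclideanSpace ℝ (Fin n) → ℂ} (hu : MemW012 D u) (hsol : IsDistribSolution D V u) :
    u =ᵐ[volume.restrict (D : Set (EuclideanSpace ℝ (Fin n)))] 0 := by
  obtain ⟨hu2, G, hG, hG2, φ, hφu, hφG⟩ := hu
  obtain ⟨G', hG', hsol⟩ := hsol
  have hGG := fun i => hG'.ae_eq hG i
  set μ := volume.restrict (D : Set (EuclideanSpace ℝ (Fin n))) with hμ
  -- The equation is bilinear, so testing with the conjugate of `φₖ` produces the Hermitian pairing.
  have hsol' : ∀ k, ∫ x, ∑ i, G i x * starRingEnd ℂ (partialDeriv i (φ k) x) ∂μ =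
      ∫ x, (V x : ℂ) * u x * starRingEnd ℂ (φ k x) ∂μ := by
    intro k
    have := hsol (conjTestFunction (φ k))
    simp only [partialDeriv_conjTestFunction, conjTestFunction_apply] at this
    rw [← this]
    refine integral_congr_ae ?_
    filter_upwards [ae_all_iff.2 hGG] with x hx
    simp [hx]
  have hpm : ∀ k i, AEStronglyMeasurable (partialDeriv i (φ k)) μ := fun k i =>
    (continuous_partialDeriv (φ k) i).aestronglyMeasurable
  have hpL : ∀ k i, MemLp (partialDeriv i (φ k)) 2 μ := fun k i =>
    ((continuous_partialDeriv (φ k) i).memLp_of_hasCompactSupport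
      (hasCompactSupport_partialDeriv (φ k) i)).restrict _
  have hφL : ∀ k, MemLp (φ k) 2 μ := fun k =>
    ((φ k).continuous.memLp_of_hasCompactSupport (φ k).hasCompactSupport).restrict _
  -- Hardy's inequality for the limit
  have hardyu : ∫⁻ x, (W x + ENNReal.ofReal β) * ‖u x‖ₑ ^ 2 ∂μ ≤ ∫⁻ x, ∑ i, ‖G i x‖ₑ ^ 2 ∂μ := by
    obtain ⟨ns, hns, hae⟩ :=
      (tendstoInMeasure_of_tendsto_eLpNorm two_ne_zero (fun k => (hφL k).1) hu2.1
        hφu).exists_seq_tendsto_ae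
    -- The varying factor is now `|φₖ|²` and the fixed one is `W + β`; Minkowski bounds `‖∂ᵢφₖ‖₂` by
    -- a convergent sequence.
    have h := lintegral_mul_le_of_le_liminf (μ := μ) (w := fun k x => ‖φ (ns k) x‖ₑ ^ 2)
      (W := fun x => ‖u x‖ₑ ^ 2) (g := fun x => W x + ENNReal.ofReal β)
      (c := fun k => ∑ i, (eLpNorm (fun x => partialDeriv i (φ (ns k)) x - G i x) 2 μ +
        eLpNorm (G i) 2 μ) ^ 2) (C := ∑ i, (0 + eLpNorm (G i) 2 μ) ^ 2)
      (fun k => (hφL (ns k)).1.enorm.pow_const 2) (hW.add_const _) ?_ ?_ ?_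
    · simp only [mul_comm (_ + _ : ℝ≥0∞)]
      refine h.trans_eq ?_
      rw [lintegral_finsetSum' _ fun i _ => (hG2 i).1.enorm.pow_const 2]
      simp [lintegral_enorm_sq_eq_eLpNorm]
    · intro k
      simp only [mul_comm _ (_ + _ : ℝ≥0∞)]
      refine (hardy (φ (ns k))).trans ?_
      rw [lintegral_finsetSum' _ fun i _ => (hpm (ns k) i).enorm.pow_const 2]
      refine Finset.sum_le_sum fun i _ => ?_
      rw [lintegral_enorm_sq_eq_eLpNorm]
      refine pow_le_pow_left' ?_ 2
      refine le_trans (le_of_eq ?_) (eLpNorm_add_le ((hpm (ns k) i).sub (hG2 i).1) (hG2 i).1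
        one_le_two)
      congr 1
      ext x; simp
    · refine tendsto_finsetSum _ fun i _ => ?_
      exact (ENNReal.continuous_pow 2).tendsto _ |>.comp
        (((hφG i).comp hns.tendsto_atTop).add tendsto_const_nhds)
    · filter_upwards [hae] with x hx
      exact ((ENNReal.continuous_pow 2).tendsto _ |>.comp hx.enorm).liminf_eq.ge
  have hWu : AEMeasurable (fun x => W x * ‖u x‖ₑ ^ 2) μ := hW.mul (hu2.1.enorm.pow_const 2)
  have hGint : ∀ i, Integrable (fun x => ‖G i x‖ ^ 2) μ := fun i =>
    (hG2 i).integrable_norm_pow two_ne_zero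
  have hpint : ∀ k i, Integrable (fun x => ‖partialDeriv i (φ k) x‖ ^ 2) μ := fun k i =>
    (hpL k i).integrable_norm_pow two_ne_zero
  have hdint : ∀ k i, Integrable (fun x => ‖partialDeriv i (φ k) x - G i x‖ ^ 2) μ := fun k i =>
    ((hpL k i).sub (hG2 i)).integrable_norm_pow two_ne_zero
  have toR : ∀ f : Fin n → EuclideanSpace ℝ (Fin n) → ℂ,
      (∀ i, Integrable (fun x => ‖f i x‖ ^ 2) μ) →
      ∫⁻ x, ∑ i, ‖f i x‖ₑ ^ 2 ∂μ = ENNReal.ofReal (∫ x, ∑ i, ‖f i x‖ ^ 2 ∂μ) := by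
    intro f hf
    rw [ofReal_integral_eq_lintegral_ofReal (integrable_finsetSum _ fun i _ => hf i)
      (ae_of_all _ fun x => by simp only [Pi.zero_apply]; positivity)]
    refine lintegral_congr fun x => ?_
    rw [ENNReal.ofReal_sum_of_nonneg fun i _ => by positivity]
    exact Finset.sum_congr rfl fun i _ => by
      rw [← ofReal_norm, ← ENNReal.ofReal_pow (norm_nonneg _)]
  -- the form of `-Δ - W` at `φ k` and at `u` bounds the error in the equation
  have main : ∀ k, ENNReal.ofReal β * ∫⁻ x, ‖u x‖ₑ ^ 2 ∂μ ≤
      ∫⁻ x, ∑ i, ‖partialDeriv i (φ k) x - G i x‖ₑ ^ 2 ∂μ := by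
    intro k
    -- The remainder `β` is discarded for `φₖ` and kept for `u`.
    have hk := (lintegral_mono fun x => mul_le_mul_left (le_self_add (a := W x)
      (b := ENNReal.ofReal β)) (‖φ k x‖ₑ ^ 2)).trans (hardy (φ k))
    have hu' : ∫⁻ x, W x * ‖u x‖ₑ ^ 2 ∂μ + ENNReal.ofReal β * ∫⁻ x, ‖u x‖ₑ ^ 2 ∂μ ≤
        ∫⁻ x, ∑ i, ‖G i x‖ₑ ^ 2 ∂μ := by
      refine le_trans (le_of_eq ?_) hardyu
      rw [← lintegral_const_mul'' _ (hu2.1.enorm.pow_const 2),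
        ← lintegral_add_left' hWu]
      simp only [add_mul]
    rw [toR _ (hGint)] at hu'
    rw [toR _ (hpint k)] at hk
    rw [toR _ (hdint k)]
    have hid : ∫ x, ∑ i, ‖partialDeriv i (φ k) x - G i x‖ ^ 2 ∂μ =
        ∫ x, ∑ i, ‖G i x‖ ^ 2 ∂μ + ∫ x, ∑ i, ‖partialDeriv i (φ k) x‖ ^ 2 ∂μ -
          2 * (∫ x, ∑ i, G i x * starRingEnd ℂ (partialDeriv i (φ k) x) ∂μ).re := by
      have hm : ∀ i, Integrable (fun x => G i x * starRingEnd ℂ (partialDeriv i (φ k) x)) μ :=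
        fun i => (hG2 i).integrable_mul (hpL k i).star
      have hre := Complex.reCLM.integral_comp_comm (integrable_finsetSum Finset.univ fun i _ => hm i)
      simp only [Complex.reCLM_apply] at hre
      have hs1 := integrable_finsetSum Finset.univ fun i _ => hGint i
      have hs2 := integrable_finsetSum Finset.univ fun i _ => hpint k i
      rw [← hre, ← integral_add hs1 hs2, ← integral_const_mul, ← integral_sub]
      · refine integral_congr_ae (ae_of_all _ fun x => ?_)
        simp only [Complex.re_sum, Finset.mul_sum, ← Finset.sum_add_distrib,
          ← Finset.sum_sub_distrib]
        refine Finset.sum_congr rfl fun i _ => ?_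
        simp only [Complex.sq_norm, Complex.normSq_apply, Complex.sub_re, Complex.sub_im,
          Complex.mul_re, Complex.conj_re, Complex.conj_im]
        ring
      · exact hs1.add hs2
      · exact (Complex.reCLM.integrable_comp
          (integrable_finsetSum Finset.univ fun i _ => hm i)).const_mul 2
    have hle : 2 * ENNReal.ofReal ‖∫ x, (V x : ℂ) * u x * starRingEnd ℂ (φ k x) ∂μ‖ ≤
        ∫⁻ x, W x * ‖u x‖ₑ ^ 2 ∂μ + ∫⁻ x, W x * ‖φ k x‖ₑ ^ 2 ∂μ := by
      rw [ofReal_norm, ← lintegral_add_left' hWu]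
      -- Pointwise `2|V u φₖ| ≤ W(|u|² + |φₖ|²)`; no integrability of the product has to be known
      -- beforehand.
      refine (mul_le_mul_right (enorm_integral_le_lintegral_enorm _) 2).trans ?_
      rw [← lintegral_const_mul' _ _ (by simp)]
      refine lintegral_mono_ae ?_
      filter_upwards [hV] with x hx
      have h1 : ‖(V x : ℂ) * u x * starRingEnd ℂ (φ k x)‖ₑ =
          ENNReal.ofReal |V x| * (‖u x‖ₑ * ‖φ k x‖ₑ) := by
        simp only [← ofReal_norm, norm_mul, Complex.norm_real, Real.norm_eq_abs, RCLike.norm_conj]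
        rw [mul_assoc, ENNReal.ofReal_mul (abs_nonneg _), ENNReal.ofReal_mul (norm_nonneg _)]
      have h2 : 2 * (‖u x‖ₑ * ‖φ k x‖ₑ) ≤ ‖u x‖ₑ ^ 2 + ‖φ k x‖ₑ ^ 2 := by
        rw [enorm_eq_nnnorm, enorm_eq_nnnorm]
        have := two_mul_le_add_sq ‖u x‖₊ ‖φ k x‖₊
        rw [mul_assoc] at this
        exact_mod_cast this
      rw [h1, ← mul_add, mul_left_comm]
      exact mul_le_mul' hx h2
    -- Finiteness allows `∫ W|u|²` and `∫ W|φₖ|²` to cancel in `ℝ`, leaving only the remainder term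
    -- `U`.
    have hp : ∫⁻ x, W x * ‖u x‖ₑ ^ 2 ∂μ ≠ ∞ := ne_top_of_le_ne_top ENNReal.ofReal_ne_top
      (le_self_add.trans hu')
    have hU : ENNReal.ofReal β * ∫⁻ x, ‖u x‖ₑ ^ 2 ∂μ ≠ ∞ :=
      ne_top_of_le_ne_top ENNReal.ofReal_ne_top (le_add_self.trans hu')
    have hq : ∫⁻ x, W x * ‖φ k x‖ₑ ^ 2 ∂μ ≠ ∞ := ne_top_of_le_ne_top ENNReal.ofReal_ne_top hk
    have hA0 : 0 ≤ ∫ x, ∑ i, ‖G i x‖ ^ 2 ∂μ := integral_nonneg fun x => by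
      simp only [Pi.zero_apply]; positivity
    have hB0 : 0 ≤ ∫ x, ∑ i, ‖partialDeriv i (φ k) x‖ ^ 2 ∂μ := integral_nonneg fun x => by
      simp only [Pi.zero_apply]; positivity
    have hre := (Complex.re_le_norm _).trans_eq (congrArg norm (hsol' k))
    generalize ∫⁻ x, W x * ‖u x‖ₑ ^ 2 ∂μ = p at *
    generalize ENNReal.ofReal β * ∫⁻ x, ‖u x‖ₑ ^ 2 ∂μ = U at *
    generalize ∫⁻ x, W x * ‖φ k x‖ₑ ^ 2 ∂μ = q at *
    lift p to NNReal using hp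
    lift U to NNReal using hU
    lift q to NNReal using hq
    have e1 := ENNReal.toReal_mono ENNReal.ofReal_ne_top hu'
    have e2 := ENNReal.toReal_mono ENNReal.ofReal_ne_top hk
    have e3 := ENNReal.toReal_mono (by simp) hle
    rw [ENNReal.toReal_add (by simp) (by simp)] at e1 e3
    rw [ENNReal.toReal_ofReal hA0] at e1
    rw [ENNReal.toReal_ofReal hB0] at e2
    rw [ENNReal.toReal_mul, ENNReal.toReal_ofReal (norm_nonneg _)] at e3
    simp only [ENNReal.coe_toReal, ENNReal.toReal_ofNat] at e1 e2 e3
    refine ENNReal.le_ofReal_iff_toReal_le (by simp) ?_ |>.2 ?_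
    · exact integral_nonneg fun x => by simp only [Pi.zero_apply]; positivity
    · rw [hid, ENNReal.coe_toReal]
      linarith
  have hlim : Tendsto (fun k => ∫⁻ x, ∑ i, ‖partialDeriv i (φ k) x - G i x‖ₑ ^ 2 ∂μ) atTop
      (𝓝 0) := by
    have h : ∀ k, ∫⁻ x, ∑ i, ‖partialDeriv i (φ k) x - G i x‖ₑ ^ 2 ∂μ =
        ∑ i, eLpNorm (fun x => partialDeriv i (φ k) x - G i x) 2 μ ^ 2 := by
      intro k
      have hm : ∀ i, AEMeasurable (fun x => ‖partialDeriv i (φ k) x - G i x‖ₑ ^ 2) μ :=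
        fun i => ((hpm k i).sub (hG2 i).1).enorm.pow_const 2
      rw [lintegral_finsetSum' _ fun i _ => hm i]
      simp only [lintegral_enorm_sq_eq_eLpNorm]
    simp only [h]
    have := tendsto_finsetSum Finset.univ fun i (_ : i ∈ Finset.univ) =>
      ((ENNReal.continuous_pow 2).tendsto 0).comp (hφG i)
    simpa [Function.comp_def] using this
  have h0 := ge_of_tendsto' hlim main
  rw [nonpos_iff_eq_zero, mul_eq_zero, lintegral_eq_zero_iff' (hu2.1.enorm.pow_const 2)] at h0
  filter_upwards [h0.resolve_left (by simpa using hβ)] with x hx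
  simpa using hx

end HardySchrodinger

/-! ### The two cases of the theorem -/

theorem theorem2p3 (n : ℕ) (hn : 2 ≤ n)
    (D : TopologicalSpace.Opens (EuclideanSpace ℝ (Fin n)))
    (hDc : IsConnected (D : Set (EuclideanSpace ℝ (Fin n))))
    (hDb : Bornology.IsBounded (D : Set (EuclideanSpace ℝ (Fin n))))
    (V : EuclideanSpace ℝ (Fin n) → ℝ)
    (hVm : AEMeasurable V (volume.restrict (D : Set (EuclideanSpace ℝ (Fin n)))))
    (hV :
      (∀ᵐ x ∂(volume.restrict (D : Set (EuclideanSpace ℝ (Fin n)))),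
        |V x| ≤ (((n : ℝ) - 2) / 2) ^ 2 * (‖x‖ ^ 2)⁻¹) ∨
      (Convex ℝ (D : Set (EuclideanSpace ℝ (Fin n))) ∧
        ∀ᵐ x ∂(volume.restrict (D : Set (EuclideanSpace ℝ (Fin n)))),
          |V x| ≤ (1 / 4 : ℝ) * (HardySchrodinger.distBoundary D x ^ 2)⁻¹))
    (u : EuclideanSpace ℝ (Fin n) → ℂ)
    (hu : HardySchrodinger.MemW012 D u)
    (hsol : HardySchrodinger.IsDistribSolution D V u) :
    u =ᵐ[volume.restrict (D : Set (EuclideanSpace ℝ (Fin n)))] 0 := by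
  obtain ⟨R, hR0, hR⟩ := hDb.exists_pos_norm_le
  have hβ : 0 < 1 / (16 * R ^ 2) := by positivity
  have hβR : 16 * (1 / (16 * R ^ 2)) * R ^ 2 = 1 := by field_simp
  rcases hV with hV | ⟨hc, hV⟩
  -- For `n = 2` the weight vanishes and only the Poincaré term `β` remains.
  · have hn2 : (2 : ℝ) ≤ n := by exact_mod_cast hn
    refine HardySchrodinger.ae_eq_zero_of_hardy
      (W := fun x => ENNReal.ofReal ((((n : ℝ) - 2) / 2) ^ 2 * (‖x‖ ^ 2)⁻¹)) (by fun_prop) hβ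
      (HardySchrodinger.lintegral_inverse_square_le (by linarith) (by ring) hβ fun x hx => ?_)
      (hV.mono fun x hx => ENNReal.ofReal_le_ofReal hx) hu hsol
    have := pow_le_pow_left₀ (norm_nonneg x) (hR x hx) 2
    nlinarith [mul_le_mul_of_nonneg_left this hβ.le]
  · have : Nonempty (Fin n) := ⟨⟨0, by omega⟩⟩
    have hfr : (frontier (D : Set (EuclideanSpace ℝ (Fin n)))).Nonempty := by
      refine nonempty_frontier_iff.2 ⟨hDc.nonempty, fun h => ?_⟩
      rw [h] at hDb
      exact NormedSpace.unbounded_univ ℝ _ hDb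
    refine HardySchrodinger.ae_eq_zero_of_hardy
      (W := fun x => ENNReal.ofReal (1 / 4 * (HardySchrodinger.distBoundary D x ^ 2)⁻¹)) ?_ hβ
      (HardySchrodinger.lintegral_inverse_square_distBoundary_le hc hDc.nonempty hfr hβ hR hβR.le)
      (hV.mono fun x hx => ENNReal.ofReal_le_ofReal hx) hu hsol
    have : Measurable (HardySchrodinger.distBoundary D) :=
      (Metric.continuous_infDist_pt _).measurable
    fun_prop
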